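/- **Theorem (Ordinal single-item algorithm).** In the *ordinal single-item Byzantine secretary problem* there are $n\ge 2$ elements, partitioned into red elements $R$ and green elements $G$ with $|G|\ge 2$. An adversary first fixes the partition, a strict total order on all $n$ elements (their values $v(e)$), and an arrival time in $[0,1]$ for every red element (together with the order in which elements with the same arrival time are presented). Then every green element independently receives a uniformly random arrival time in $[0,1]$. The elements are presented one by one in the order of arrival. An algorithm knows $n$, but neither the colors nor $|R|$, $|G|$; when an element arrives it sees its arrival time and its rank relative to the elements that have arrived before, and it must irrevocably select or discard the element before the next one is presented, on the basis of the arrival times and relative ranks seen so far. It may select at most one element. A randomized algorithm is a probability distribution over (measurable) deterministic algorithms, drawn independently of the green arrival times. Let $g_2$ denote the second-largest green element. There are an absolute constant $c>0$ and, for every $n$, a randomized algorithm $\mathcal A_n$ such that for every $n\ge 2$ and every input as above, $\mathcal A_n$ selects an element $e$ with $v(e)\ge v(g_2)$ with probability at least $c/(\log n)^2$, the probability being over the green arrival times and the randomness of the algorithm. -/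

import Mathlib

namespace ByzantineSecretary

open MeasureTheory

/-- A pure input of the ordinal Byzantine secretary problem on the universe `Fin n`, fixed by the
adversary in advance. Elements outside `red` are green. The labels in `Fin n` are never shown to
the algorithm; they only break ties between equal arrival times, so that the adversary, who is
free to choose the labelling, also chooses in which order simultaneous red elements arrive. -/
structure Input (n : ℕ) where
  /-- the red elements -/
  red : Finset (Fin n)
  /-- the arrival times of the red elements -/
  redTime : {e // e ∈ red} → unitInterval
  /-- the total order on the elements: `v e` is the rank of `e`, larger being better -/
  v : Equiv.Perm (Fin n)
  /-- at least two elements are green, so that the second-largest green element exists -/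
  two_le_card_green : 2 ≤ (redᶜ).card

namespace Input

variable {n : ℕ} (I : Input n)

/-- The green elements. -/
def green : Finset (Fin n) := I.redᶜ

/-- The set of values of the green elements. -/
def greenValues : Finset (Fin n) := I.green.image I.v

theorem card_greenValues : 2 ≤ I.greenValues.card := by
  unfold greenValues
  rw [Finset.card_image_of_injective _ I.v.injective]
  exact I.two_le_card_green

theorem greenValues_nonempty : I.greenValues.Nonempty :=
  Finset.card_pos.mp (lt_of_lt_of_le two_pos I.card_greenValues)

/-- The value of the largest green element. -/
def topGreenValue : Fin n := I.greenValues.max' I.greenValues_nonempty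

theorem erase_nonempty : (I.greenValues.erase I.topGreenValue).Nonempty := by
  apply Finset.card_pos.mp
  have h := Finset.pred_card_le_card_erase (s := I.greenValues) (a := I.topGreenValue)
  have h2 := I.card_greenValues
  omega

/-- The value of the second-largest green element. -/
def secondGreenValue : Fin n :=
  (I.greenValues.erase I.topGreenValue).max' I.erase_nonempty

/-- The arrival times: red elements arrive when the adversary says, a green element `e` arrives
at its random time `u e` (the coordinates of `u` at red elements are not used). -/
def arrival (u : Fin n → unitInterval) (e : Fin n) : unitInterval :=
  if h : e ∈ I.red then I.redTime ⟨e, h⟩ else u e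

/-- `I.nth u k` is the `k`-th element to arrive (`k = 0` is the first): the elements are sorted by
arrival time, ties being broken by label. -/
noncomputable def nth (u : Fin n → unitInterval) : Equiv.Perm (Fin n) := Tuple.sort (I.arrival u)

/-- What is revealed when the `k`-th element arrives: its arrival time, and its relative rank,
i.e. the number of elements that arrived before it and have a smaller value. -/
noncomputable def observation (u : Fin n → unitInterval) (k : Fin n) : unitInterval × ℕ :=
  (I.arrival u (I.nth u k),
    (Finset.univ.filter fun j : Fin n => j < k ∧ I.v (I.nth u j) < I.v (I.nth u k)).card)

end Input

/-- The information available when the `k`-th element has just arrived: the arrival times and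
relative ranks of the elements that have arrived so far, including the current one. -/
abbrev History (n : ℕ) (k : Fin n) : Type := Set.Iic k → unitInterval × ℕ

/-- A deterministic online algorithm for `n` elements: at each arrival, it decides from the
history whether it wants to select the current element (`true`) or to discard it (`false`). -/
abbrev DetAlgorithm (n : ℕ) : Type := (k : Fin n) → History n k → Bool

/-- The history of the input `I` with green arrival times `u`, up to the `k`-th arrival. -/
noncomputable def Input.history {n : ℕ} (I : Input n) (u : Fin n → unitInterval) (k : Fin n) : History n k :=
  fun j => I.observation u j

/-- On the input `I` with green arrival times `u`, the algorithm `A` selects the `k`-th element to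
arrive. Selection is irrevocable and only one element may be selected, so this is the first
arrival that `A` accepts. -/
def Selects {n : ℕ} (A : DetAlgorithm n) (I : Input n) (u : Fin n → unitInterval)
    (k : Fin n) : Prop :=
  A k (I.history u k) = true ∧ ∀ j < k, A j (I.history u j) = false

/-- The algorithm `A` selects some element whose value is at least that of the second-largest
green element. -/
def Wins {n : ℕ} (A : DetAlgorithm n) (I : Input n) (u : Fin n → unitInterval) : Prop :=
  ∃ k : Fin n, Selects A I u k ∧ I.secondGreenValue ≤ I.v (I.nth u k)

/-- A randomized algorithm for `n` elements: a random deterministic algorithm `alg ω`, where the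
seed `ω` is drawn from a probability space, depending measurably on the seed and the history. -/
structure RandAlgorithm (n : ℕ) where
  /-- the space of seeds -/
  Ω : Type
  /-- its measurable sets -/
  mΩ : MeasurableSpace Ω
  /-- the distribution of the seed -/
  μ : Measure Ω
  /-- the distribution is a probability measure -/
  prob : IsProbabilityMeasure μ
  /-- the deterministic algorithm run on a given seed -/
  alg : Ω → DetAlgorithm n
  /-- decisions are measurable -/
  measurable_alg : ∀ k : Fin n, Measurable fun p : Ω × History n k => alg p.1 k p.2

/-- The probability that the randomized algorithm `A` wins on the input `I`, over its own seed and,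
independently of it, the independent uniform arrival times of the green elements. -/
noncomputable def RandAlgorithm.payoff {n : ℕ} (A : RandAlgorithm n) (I : Input n) : ℝ :=
  letI := A.mΩ
  (A.μ.prod (volume : Measure (Fin n → unitInterval))).real {p | Wins (A.alg p.1) I p.2}

end ByzantineSecretary

/-! Let `L = log₂ n + 1`, so `n < 2 ^ L`, and cut `[0, 1]` into `3L` phases. Write `g₁`, `g₂` for
the two best green elements. The algorithm guesses a rule, a middle phase `L + i` and a scale `2 ^
j`; there are `2L²` seeds. If some middle phase has no red element above `g₂`, then with probability
`1/(9L)` `g₂` falls in it and `g₁` in the last third. Then `g₂` is the best of that phase, and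
accepting the first later element that beats the phase succeeds (`wins_of_phase_eq`); `j` is
irrelevant, so `L` seeds win. Otherwise every middle phase contains a red element above `g₂`. If
`g₂` arrives in the first third, it stays among the survivors: the early elements that are beaten in
every middle phase so far. The number of survivors at least as good as `g₂` lies between `1` and `n
< 2 ^ L`, so in some phase more than half of them survive. With that phase and the right scale, a
rank among the survivors gives a threshold that is at least `g₂` and is still beaten
(`exists_beatsSurvivor`). One seed wins, on an event of probability `1/3`. -/

namespace ByzantineSecretary

open MeasureTheory

/-! ### Comparisons recovered from relative ranks -/

/-- The number of elements that precede `j` and have a smaller value. -/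
def relativeRank {n : ℕ} (σ : Fin n → Fin n) (j : Fin n) : ℕ :=
  (Finset.univ.filter fun i : Fin n => i < j ∧ σ i < σ j).card

/-- The positions before `j` with value below `σ j` are the lowest `relativeRank σ j` ones in value,
so membership of `i` is decided by its own rank among them. -/
theorem lt_iff_card_lt_relativeRank {n : ℕ} {σ : Fin n → Fin n} (hσ : Function.Injective σ)
    {i j : Fin n} (hij : i < j) :
    σ i < σ j ↔
      (Finset.univ.filter fun a : Fin n => a < j ∧ σ a < σ i).card < relativeRank σ j := by
  unfold relativeRank
  constructor
  · intro h
    apply Finset.card_lt_card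
    rw [Finset.ssubset_iff_of_subset]
    · exact ⟨i, by simp [hij, h], by simp⟩
    · intro a
      simp only [Finset.mem_filter, Finset.mem_univ, true_and]
      exact fun ha => ⟨ha.1, ha.2.trans h⟩
  · intro h
    by_contra hle
    have hlt : σ j < σ i := lt_of_le_of_ne (not_lt.mp hle) fun e => hij.ne' (hσ e)
    refine absurd h (not_lt.mpr (Finset.card_le_card ?_))
    intro a
    simp only [Finset.mem_filter, Finset.mem_univ, true_and]
    exact fun ha => ⟨ha.1, ha.2.trans hlt⟩

/-- Relative ranks determine the relative order. -/
theorem lt_iff_lt_of_relativeRank_eq {n : ℕ} {σ τ : Fin n → Fin n} (hσ : Function.Injective σ)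
    (hτ : Function.Injective τ) (k : ℕ)
    (h : ∀ j : Fin n, (j : ℕ) ≤ k → relativeRank σ j = relativeRank τ j) :
    ∀ a b : Fin n, (a : ℕ) ≤ k → (b : ℕ) ≤ k → (σ a < σ b ↔ τ a < τ b) := by
  -- The order before `j` fixes the left-hand count of the rank criterion, so equal ranks at `j`
  -- place `j` identically.
  have key : ∀ j : Fin n, (∀ a b : Fin n, a < j → b < j → (σ a < σ b ↔ τ a < τ b)) →
      (j : ℕ) ≤ k → ∀ i < j, (σ i < σ j ↔ τ i < τ j) := by
    intro j ih hj i hij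
    rw [lt_iff_card_lt_relativeRank hσ hij, lt_iff_card_lt_relativeRank hτ hij, h j hj]
    have : (Finset.univ.filter fun a : Fin n => a < j ∧ σ a < σ i)
        = Finset.univ.filter fun a : Fin n => a < j ∧ τ a < τ i := by
      apply Finset.filter_congr
      intro a _
      exact and_congr_right fun ha => ih a i ha hij
    rw [this]
  have main : ∀ m ≤ k, ∀ a b : Fin n, (a : ℕ) ≤ m → (b : ℕ) ≤ m → (σ a < σ b ↔ τ a < τ b) := by
    intro m
    induction m using Nat.strong_induction_on with
    | _ m ih =>
      intro hm a b ha hb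
      have step : ∀ i j : Fin n, (j : ℕ) ≤ m → i < j → (σ i < σ j ↔ τ i < τ j) := by
        intro i j hj hij
        refine key j (fun a b ha hb => ?_) (hj.trans hm) i hij
        have ha' : (a : ℕ) < j := ha
        have hb' : (b : ℕ) < j := hb
        exact ih (j - 1) (by omega) (by omega) a b (by omega) (by omega)
      rcases lt_trichotomy a b with hab | rfl | hab
      · exact step a b hb hab
      · simp
      · have hs := step b a ha hab
        rw [← not_le, ← not_le, (hσ.ne hab.ne).le_iff_lt, (hτ.ne hab.ne).le_iff_lt, hs]
  exact main k le_rfl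

/-- The comparison of two positions up to `k` that the relative ranks `r` reveal. -/
def RevealedLT {n : ℕ} (r : Fin n → ℕ) (k a b : Fin n) : Prop :=
  a ≤ k ∧ b ≤ k ∧ ∃ σ : Equiv.Perm (Fin n), (∀ j ≤ k, relativeRank σ j = r j) ∧ σ a < σ b

/-- The existential in `RevealedLT` does not depend on its witness: any two permutations with these
ranks agree up to `k`. -/
theorem revealedLT_iff {n : ℕ} (σ : Equiv.Perm (Fin n)) (r : Fin n → ℕ) (k : Fin n)
    (hr : ∀ j ≤ k, relativeRank σ j = r j) (a b : Fin n) :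
    RevealedLT r k a b ↔ a ≤ k ∧ b ≤ k ∧ σ a < σ b := by
  constructor
  · rintro ⟨ha, hb, τ, hτ, h⟩
    refine ⟨ha, hb, ?_⟩
    refine (lt_iff_lt_of_relativeRank_eq τ.injective σ.injective k ?_ a b ha hb).mp h
    intro j hj
    rw [hτ j hj, hr j hj]
  · rintro ⟨ha, hb, h⟩
    exact ⟨ha, hb, σ, hr, h⟩

/-! ### The two acceptance rules and their online character -/

/-- Position `k` comes after phase `p` and beats every element of phase `p`. -/
def BeatsPhase {n : ℕ} (p : ℕ) (ph : Fin n → ℕ) (lt : Fin n → Fin n → Prop) (k : Fin n) : Prop :=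
  p < ph k ∧ ∀ j ≤ k, ph j = p → lt j k

/-- The element at position `x` arrives in the first `L` phases, and each of the phases from `L`
up to `p` contains a better element. -/
def IsSurvivor {n : ℕ} (L p : ℕ) (ph : Fin n → ℕ) (lt : Fin n → Fin n → Prop) (x : Fin n) : Prop :=
  ph x < L ∧ ∀ q, L ≤ q → q < p → ∃ y, ph y = q ∧ lt x y

/-- Position `k` comes in phase `p` or later and beats one of the best `m` survivors. -/
def BeatsSurvivor {n : ℕ} (L p m : ℕ) (ph : Fin n → ℕ) (lt : Fin n → Fin n → Prop)
    (k : Fin n) : Prop :=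
  p ≤ ph k ∧ ∃ z, IsSurvivor L p ph lt z ∧ lt z k ∧
    {x | x ≤ k ∧ IsSurvivor L p ph lt x ∧ ¬ lt x z}.ncard ≤ m

theorem beatsPhase_truncate_iff {n : ℕ} (ph : Fin n → ℕ) (σ : Equiv.Perm (Fin n)) (k : Fin n)
    (p : ℕ) :
    BeatsPhase p (fun j => if j ≤ k then ph j else 0) (fun a b => a ≤ k ∧ b ≤ k ∧ σ a < σ b) k ↔
      p < ph k ∧ ∀ j ≤ k, ph j = p → σ j < σ k := by
  unfold BeatsPhase
  simp only [le_refl, if_true, true_and]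
  refine and_congr_right fun hp => forall_congr' fun j => ?_
  refine imp_congr_right fun hj => ?_
  simp [hj]

/-- Phases are monotone, so once phase `p` is reached all elements of earlier phases have been seen.
-/
theorem isSurvivor_truncate_iff {n : ℕ} {ph : Fin n → ℕ} (hph : Monotone ph)
    (σ : Equiv.Perm (Fin n)) {k : Fin n} {L p : ℕ} (hp : p ≤ ph k) {x : Fin n} (hx : x ≤ k) :
    IsSurvivor L p (fun j => if j ≤ k then ph j else 0) (fun a b => a ≤ k ∧ b ≤ k ∧ σ a < σ b) x ↔
      IsSurvivor L p ph (fun a b => σ a < σ b) x := by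
  unfold IsSurvivor
  simp only [hx, if_true, true_and]
  refine and_congr_right fun _ => forall_congr' fun q => ?_
  refine imp_congr_right fun _ => forall_congr' fun hqp => exists_congr fun y => ?_
  constructor
  · rintro ⟨h1, h2, h3⟩
    rw [if_pos h2] at h1
    exact ⟨h1, h3⟩
  · rintro ⟨h1, h3⟩
    have h2 : y ≤ k := by
      by_contra hlt
      have := hph (not_le.mp hlt).le
      omega
    rw [if_pos h2]
    exact ⟨h1, h2, h3⟩

theorem beatsSurvivor_truncate_iff {n : ℕ} {ph : Fin n → ℕ} (hph : Monotone ph)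
    (σ : Equiv.Perm (Fin n)) (k : Fin n) {L p : ℕ} (hL : L ≤ p) (m : ℕ) :
    BeatsSurvivor L p m (fun j => if j ≤ k then ph j else 0)
        (fun a b => a ≤ k ∧ b ≤ k ∧ σ a < σ b) k ↔
      p ≤ ph k ∧ ∃ z, IsSurvivor L p ph (fun a b => σ a < σ b) z ∧ σ z < σ k ∧
        {x | IsSurvivor L p ph (fun a b => σ a < σ b) x ∧ σ z ≤ σ x}.ncard ≤ m := by
  unfold BeatsSurvivor
  simp only [le_refl, if_true, true_and]
  refine and_congr_right fun hp => exists_congr fun z => ?_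
  have hle : ∀ x, IsSurvivor L p ph (fun a b => σ a < σ b) x → x ≤ k := by
    intro x hx
    by_contra hlt
    have := hph (not_le.mp hlt).le
    have := hx.1
    omega
  -- The bound `x ≤ k` matters: unseen positions carry the default phase `0` and could pass for
  -- early elements.
  have hset : ∀ z ≤ k, {x | x ≤ k ∧
      IsSurvivor L p (fun j => if j ≤ k then ph j else 0)
        (fun a b => a ≤ k ∧ b ≤ k ∧ σ a < σ b) x ∧ ¬ (x ≤ k ∧ z ≤ k ∧ σ x < σ z)} =
      {x | IsSurvivor L p ph (fun a b => σ a < σ b) x ∧ σ z ≤ σ x} := by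
    intro z hz
    ext x
    simp only [Set.mem_ofPred_eq]
    constructor
    · rintro ⟨h1, h2, h3⟩
      exact ⟨(isSurvivor_truncate_iff hph σ hp h1).mp h2, not_lt.mp fun h => h3 ⟨h1, hz, h⟩⟩
    · rintro ⟨h2, h3⟩
      have h1 := hle x h2
      exact ⟨h1, (isSurvivor_truncate_iff hph σ hp h1).mpr h2, fun h => h3.not_gt h.2.2⟩
  constructor
  · rintro ⟨h1, ⟨hz, h2⟩, h3⟩
    rw [hset z hz] at h3
    exact ⟨(isSurvivor_truncate_iff hph σ hp hz).mp h1, h2, h3⟩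
  · rintro ⟨h1, h2, h3⟩
    have hz := hle z h1
    rw [hset z hz]
    exact ⟨(isSurvivor_truncate_iff hph σ hp hz).mpr h1, ⟨hz, h2⟩, h3⟩

/-! ### The halving argument -/

/-- A sequence of positive integers that starts below `2 ^ L` fails to halve at one of its first
`L` steps. -/
theorem exists_lt_two_mul_succ {w : ℕ → ℕ} {L : ℕ} (h0 : w 0 < 2 ^ L) (hL : 0 < w L) :
    ∃ i < L, w i < 2 * w (i + 1) := by
  by_contra! hcon
  have key : ∀ i ≤ L, 2 ^ i * w i ≤ w 0 := by
    intro i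
    induction i with
    | zero => simp
    | succ i ih =>
      intro hi
      have h1 := ih (by omega)
      have h2 := Nat.mul_le_mul_left (2 ^ i) (hcon i (by omega))
      calc 2 ^ (i + 1) * w (i + 1) = 2 ^ i * (2 * w (i + 1)) := by ring
        _ ≤ _ := h2.trans h1
  have := key L le_rfl
  have := Nat.mul_le_mul_left (2 ^ L) hL
  omega

/-- If each of the phases from `L` to `2 * L` contains an element better than `b`, then for one
of these phases and one power of two, some position beats one of the best survivors, and each such
position is better than `b`. -/
theorem exists_beatsSurvivor {n : ℕ} (ph : Fin n → ℕ) (σ : Equiv.Perm (Fin n)) {L : ℕ}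
    (hn : n < 2 ^ L) {b : Fin n} (hb : ph b < L)
    (hbetter : ∀ q, L ≤ q → q < 2 * L → ∃ y, ph y = q ∧ σ b < σ y) :
    ∃ i < L, ∃ j < L,
      (∃ k, L + i ≤ ph k ∧ ∃ z, IsSurvivor L (L + i) ph (fun a b => σ a < σ b) z ∧ σ z < σ k ∧
        {x | IsSurvivor L (L + i) ph (fun a b => σ a < σ b) x ∧ σ z ≤ σ x}.ncard ≤ 2 ^ j) ∧
      ∀ k z, IsSurvivor L (L + i) ph (fun a b => σ a < σ b) z → σ z < σ k →
        {x | IsSurvivor L (L + i) ph (fun a b => σ a < σ b) x ∧ σ z ≤ σ x}.ncard ≤ 2 ^ j →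
        σ b ≤ σ k := by
  set S : ℕ → Fin n → Prop := fun i => IsSurvivor L (L + i) ph (fun a b => σ a < σ b) with hS
  set W : ℕ → Set (Fin n) := fun i => {x | S i x ∧ σ b ≤ σ x} with hW
  have hSb : ∀ i ≤ L, S i b := fun i hi => ⟨hb, fun q h1 h2 => hbetter q h1 (by omega)⟩
  have hSmono : ∀ i x, S (i + 1) x → S i x := fun i x hx =>
    ⟨hx.1, fun q h1 h2 => hx.2 q h1 (by omega)⟩
  have hw0 : (W 0).ncard < 2 ^ L := by
    refine lt_of_le_of_lt (Set.ncard_le_card (W 0)) ?_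
    simpa using hn
  have hwpos : ∀ i ≤ L, 0 < (W i).ncard := fun i hi =>
    (Set.ncard_pos (Set.toFinite _)).mpr ⟨b, hSb i hi, le_rfl⟩
  obtain ⟨i, hi, hhalf⟩ := exists_lt_two_mul_succ (w := fun i => (W i).ncard) hw0 (hwpos L le_rfl)
  have hsub : W (i + 1) ⊆ W i := fun x hx => ⟨hSmono i x hx.1, hx.2⟩
  have hwi : (W i).ncard < 2 ^ L := by
    refine lt_of_le_of_lt (Set.ncard_le_card (W i)) ?_
    simpa using hn
  -- The scale satisfies `2 ^ j ≤ |W i| < 2 ^ (j + 1)`.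
  set j := Nat.log 2 (W i).ncard with hj
  have hne : (W i).ncard ≠ 0 := (hwpos i hi.le).ne'
  have hj1 : 2 ^ j ≤ (W i).ncard := Nat.pow_log_le_self 2 hne
  have hj2 : (W i).ncard < 2 ^ (j + 1) := Nat.lt_pow_succ_log_self one_lt_two _
  refine ⟨i, hi, j, Nat.log_lt_of_lt_pow hne hwi, ?_, ?_⟩
  -- Take for `z` the best element to survive phase `L + i` as well; that phase itself supplies some
  -- `k` beating it.
  · obtain ⟨z, hz, hzmax⟩ := Set.exists_max_image {x | S (i + 1) x} σ (Set.toFinite _)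
      ⟨b, hSb (i + 1) hi⟩
    obtain ⟨k, hk, hzk⟩ := hz.2 (L + i) (by omega) (by omega)
    refine ⟨k, hk.ge, z, hSmono i z hz, hzk, ?_⟩
    have hbz : σ b ≤ σ z := hzmax b (hSb (i + 1) hi)
    -- Any other survivor above `z` is lost in phase `L + i`, and fewer than half of `W i` are lost.
    have hincl : {x | S i x ∧ σ z ≤ σ x} ⊆ insert z (W i \ W (i + 1)) := by
      rintro x ⟨hx, hzx⟩
      rcases eq_or_ne x z with rfl | hxz
      · exact Set.mem_insert _ _
      · refine Set.mem_insert_of_mem _ ⟨⟨hx, hbz.trans hzx⟩, fun hx' => hxz ?_⟩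
        exact σ.injective (le_antisymm (hzmax x hx'.1) hzx)
    have h1 := Set.ncard_le_ncard hincl (Set.toFinite _)
    have h2 := Set.ncard_insert_le z (W i \ W (i + 1))
    have h3 := Set.ncard_sdiff_add_ncard_of_subset hsub (Set.toFinite _)
    have h4 : 2 ^ (j + 1) = 2 * 2 ^ j := by ring
    have h5 : {x | S i x ∧ σ z ≤ σ x}.ncard ≤ 2 ^ j := by omega
    exact h5
  · intro k z hz hzk hcard
    by_contra hlt
    have hzb : σ z < σ b := hzk.trans (not_le.mp hlt)
    -- A threshold `z` below `b` has all of `W i` and itself at or above it, more than `2 ^ j`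
    -- survivors.
    have hincl : insert z (W i) ⊆ {x | S i x ∧ σ z ≤ σ x} := by
      rintro x (rfl | hx)
      · exact ⟨hz, le_rfl⟩
      · exact ⟨hx.1, hzb.le.trans hx.2⟩
    have h1 := Set.ncard_le_ncard hincl (Set.toFinite _)
    have hnot : z ∉ W i := fun h => h.2.not_gt hzb
    rw [Set.ncard_insert_of_notMem hnot (Set.toFinite _)] at h1
    have h2 := h1.trans hcard
    omega

/-! ### Phases and the randomized algorithm -/

/-- The index of the interval containing `t` when `[0, 1]` is cut into `3 * L` equal intervals. -/
noncomputable def phase (L : ℕ) (t : unitInterval) : ℕ := ⌊3 * (L : ℝ) * t⌋₊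

theorem phase_mono (L : ℕ) : Monotone (phase L) := by
  intro s t h
  have h' : (s : ℝ) ≤ t := h
  exact Nat.floor_le_floor (by gcongr)

theorem measurable_phase (L : ℕ) : Measurable (phase L) :=
  Nat.measurable_floor.comp (measurable_subtype_coe.const_mul _)

/-- The phases and relative ranks in a history, extended by zero to the positions to come. -/
noncomputable def phasesAndRanks {n : ℕ} (L : ℕ) (k : Fin n) (h : History n k) (j : Fin n) : ℕ × ℕ :=
  if hj : j ≤ k then (phase L (h ⟨j, hj⟩).1, (h ⟨j, hj⟩).2) else (0, 0)

theorem measurable_phasesAndRanks {n : ℕ} (L : ℕ) (k : Fin n) :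
    Measurable (phasesAndRanks (n := n) L k) := by
  refine measurable_pi_lambda _ fun j => ?_
  by_cases hj : j ≤ k
  · simp only [phasesAndRanks, hj, dif_pos]
    have h1 : Measurable fun h : History n k => h ⟨j, hj⟩ := measurable_pi_apply _
    exact ((measurable_phase L).comp h1.fst).prodMk h1.snd
  · simp only [phasesAndRanks, hj, dif_neg, not_false_eq_true]
    exact measurable_const

/-- The seeds: which rule to apply, a phase, and a scale. -/
abbrev Seed (L : ℕ) : Type := Bool × Fin L × Fin L

open Classical in
/-- On the seed `(false, i, j)`, accept an element that beats phase `L + i`; on the seed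
`(true, i, j)`, one that beats one of the `2 ^ j` best survivors of the phases before `L + i`. -/
noncomputable def decision {n : ℕ} (L : ℕ) (ω : Seed L) (k : Fin n) (H : Fin n → ℕ × ℕ) : Bool :=
  if ω.1 then decide (BeatsSurvivor L (L + ω.2.1) (2 ^ (ω.2.2 : ℕ)) (fun j => (H j).1)
    (RevealedLT (fun j => (H j).2) k) k)
  else decide (BeatsPhase (L + ω.2.1) (fun j => (H j).1) (RevealedLT (fun j => (H j).2) k) k)

/-- The number of scales for `n` elements. -/
def numScales (n : ℕ) : ℕ := Nat.log 2 n + 1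

/-- The algorithm that draws a seed uniformly and applies the rule that it prescribes. -/
noncomputable def ordinalAlgorithm (n : ℕ) : RandAlgorithm n where
  Ω := Seed (numScales n)
  mΩ := ⊤
  μ := @ProbabilityTheory.uniformOn (Seed (numScales n)) ⊤ Set.univ
  prob := by
    let _ : MeasurableSpace (Seed (numScales n)) := ⊤
    have : MeasurableSingletonClass (Seed (numScales n)) := ⟨fun _ => trivial⟩
    have : Nonempty (Seed (numScales n)) :=
      ⟨(true, ⟨0, Nat.succ_pos _⟩, ⟨0, Nat.succ_pos _⟩)⟩
    exact ProbabilityTheory.isProbabilityMeasure_uniformOn Set.finite_univ Set.univ_nonempty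
  alg ω k h := decision (numScales n) ω k (phasesAndRanks (numScales n) k h)
  measurable_alg k := by
    let _ : MeasurableSpace (Seed (numScales n)) := ⊤
    have : MeasurableSingletonClass (Seed (numScales n)) := ⟨fun _ => trivial⟩
    -- Seeds are finite in number, and each decision factors through the countable discrete space of
    -- phases and ranks.
    refine measurable_from_prod_countable_right fun ω => ?_
    exact (Measurable.of_discrete (f := fun H : Fin n → ℕ × ℕ =>
      decision (numScales n) ω k H)).comp (measurable_phasesAndRanks _ k)

/-! ### Winning seeds for fixed arrival times -/

namespace Input

variable {n : ℕ} (I : Input n) (u : Fin n → unitInterval)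

/-- The values in the order of arrival. -/
noncomputable def valueAt : Equiv.Perm (Fin n) := (I.nth u).trans I.v

/-- The phases in the order of arrival. -/
noncomputable def phaseAt (L : ℕ) (k : Fin n) : ℕ := phase L (I.arrival u (I.nth u k))

theorem monotone_phaseAt (L : ℕ) : Monotone (I.phaseAt u L) :=
  (phase_mono L).comp (Tuple.monotone_sort (I.arrival u))

theorem phasesAndRanks_history (L : ℕ) (k : Fin n) :
    phasesAndRanks L k (I.history u k) =
      fun j => if j ≤ k then (I.phaseAt u L j, relativeRank (I.valueAt u) j) else (0, 0) := by
  funext j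
  unfold phasesAndRanks
  split_ifs <;> rfl

theorem revealedLT_history (L : ℕ) (k : Fin n) :
    RevealedLT (fun j => (phasesAndRanks L k (I.history u k) j).2) k =
      fun a b => a ≤ k ∧ b ≤ k ∧ I.valueAt u a < I.valueAt u b := by
  funext a b
  refine propext (revealedLT_iff (I.valueAt u) _ k (fun j hj => ?_) a b)
  simp [phasesAndRanks_history, hj]

theorem phases_history (L : ℕ) (k : Fin n) :
    (fun j => (phasesAndRanks L k (I.history u k) j).1) =
      fun j => if j ≤ k then I.phaseAt u L j else 0 := by
  funext j
  rw [phasesAndRanks_history]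
  by_cases hj : j ≤ k <;> simp [hj]

theorem decision_false_iff (L : ℕ) (i j : Fin L) (k : Fin n) :
    decision L (false, i, j) k (phasesAndRanks L k (I.history u k)) = true ↔
      L + i < I.phaseAt u L k ∧
        ∀ a ≤ k, I.phaseAt u L a = L + i → I.valueAt u a < I.valueAt u k := by
  simp only [decision, Bool.false_eq_true, if_false, decide_eq_true_eq]
  rw [revealedLT_history, phases_history, beatsPhase_truncate_iff]

theorem decision_true_iff (L : ℕ) (i j : Fin L) (k : Fin n) :
    decision L (true, i, j) k (phasesAndRanks L k (I.history u k)) = true ↔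
      L + i ≤ I.phaseAt u L k ∧
        ∃ z, IsSurvivor L (L + i) (I.phaseAt u L) (fun a b => I.valueAt u a < I.valueAt u b) z ∧
          I.valueAt u z < I.valueAt u k ∧
          {x | IsSurvivor L (L + i) (I.phaseAt u L) (fun a b => I.valueAt u a < I.valueAt u b) x ∧
            I.valueAt u z ≤ I.valueAt u x}.ncard ≤ 2 ^ (j : ℕ) := by
  simp only [decision, if_true, decide_eq_true_eq]
  rw [revealedLT_history, phases_history,
    beatsSurvivor_truncate_iff (I.monotone_phaseAt u L) _ _ (Nat.le_add_right _ _)]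

/-- An algorithm that accepts some element, and only elements that are good enough, wins. -/
theorem wins_of_forall_accepted {A : DetAlgorithm n} (hex : ∃ k, A k (I.history u k) = true)
    (hgood : ∀ k, A k (I.history u k) = true → I.secondGreenValue ≤ I.valueAt u k) :
    Wins A I u := by
  classical
  obtain ⟨k, hk, hmin⟩ := WellFounded.has_min (wellFounded_lt (α := Fin n))
    {k | A k (I.history u k) = true} hex
  exact ⟨k, ⟨hk, fun j hj => Bool.eq_false_iff.mpr fun h => hmin j h hj⟩, hgood k hk⟩

/-- The largest green element. -/
def topGreen : Fin n := I.v.symm I.topGreenValue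

/-- The second-largest green element. -/
def secondGreen : Fin n := I.v.symm I.secondGreenValue

theorem topGreen_notMem_red : I.topGreen ∉ I.red := by
  have h : I.topGreenValue ∈ I.greenValues := Finset.max'_mem _ _
  obtain ⟨e, he, hev⟩ := Finset.mem_image.mp h
  rw [topGreen, ← hev, Equiv.symm_apply_apply]
  exact Finset.mem_compl.mp he

theorem secondGreenValue_mem_erase :
    I.secondGreenValue ∈ I.greenValues.erase I.topGreenValue :=
  Finset.max'_mem _ _

theorem secondGreen_notMem_red : I.secondGreen ∉ I.red := by
  obtain ⟨e, he, hev⟩ := Finset.mem_image.mp (Finset.mem_of_mem_erase I.secondGreenValue_mem_erase)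
  rw [secondGreen, ← hev, Equiv.symm_apply_apply]
  exact Finset.mem_compl.mp he

theorem secondGreenValue_lt : I.secondGreenValue < I.topGreenValue :=
  lt_of_le_of_ne (Finset.le_max' _ _ (Finset.mem_of_mem_erase I.secondGreenValue_mem_erase))
    (Finset.ne_of_mem_erase I.secondGreenValue_mem_erase)

theorem topGreen_ne_secondGreen : I.topGreen ≠ I.secondGreen := fun h =>
  I.secondGreenValue_lt.ne' (I.v.symm.injective h)

theorem value_le_secondGreenValue {e : Fin n} (he : e ∉ I.red) (hne : e ≠ I.topGreen) :
    I.v e ≤ I.secondGreenValue := by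
  refine Finset.le_max' _ _ (Finset.mem_erase.mpr ⟨fun h => hne ?_, ?_⟩)
  · rw [topGreen, ← h, Equiv.symm_apply_apply]
  · exact Finset.mem_image_of_mem _ (Finset.mem_compl.mpr he)

theorem arrival_of_notMem {e : Fin n} (he : e ∉ I.red) : I.arrival u e = u e := dif_neg he

/-- If phase `L + i` has no red element better than the second-largest green element, then the
rule that beats this phase wins as soon as the second-largest green element arrives in this phase
and the largest one later. -/
theorem wins_of_phase_eq (L : ℕ) (i j : Fin L)
    (hred : ∀ e (he : e ∈ I.red), phase L (I.redTime ⟨e, he⟩) = L + i → I.v e ≤ I.secondGreenValue)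
    (h2 : phase L (u I.secondGreen) = L + i) (h1 : L + i < phase L (u I.topGreen)) :
    Wins (fun k h => decision L (false, i, j) k (phasesAndRanks L k h)) I u := by
  have hval : ∀ e, I.valueAt u ((I.nth u).symm e) = I.v e := fun e => by simp [valueAt]
  have hph : ∀ e, I.phaseAt u L ((I.nth u).symm e) = phase L (I.arrival u e) := fun e => by
    simp [phaseAt]
  have hv2 : I.v I.secondGreen = I.secondGreenValue := by simp [secondGreen]
  have hv1 : I.v I.topGreen = I.topGreenValue := by simp [topGreen]
  apply wins_of_forall_accepted
  · refine ⟨(I.nth u).symm I.topGreen, (I.decision_false_iff u L i j _).mpr ⟨?_, ?_⟩⟩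
    · rwa [hph, I.arrival_of_notMem u I.topGreen_notMem_red]
    · intro a _ ha
      rw [hval, hv1]
      refine lt_of_le_of_lt ?_ I.secondGreenValue_lt
      change I.v (I.nth u a) ≤ _
      change phase L (I.arrival u (I.nth u a)) = _ at ha
      -- Nothing in the phase exceeds `g₂`: red elements by `hred`, green ones because `g₁` comes
      -- later.
      by_cases he : I.nth u a ∈ I.red
      · exact hred _ he (by rwa [arrival, dif_pos he] at ha)
      · refine I.value_le_secondGreenValue he fun h => ?_
        rw [I.arrival_of_notMem u he, h] at ha
        omega
  · intro k hk
    obtain ⟨hk1, hk2⟩ := (I.decision_false_iff u L i j k).mp hk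
    have hpos : I.phaseAt u L ((I.nth u).symm I.secondGreen) = L + i := by
      rw [hph, I.arrival_of_notMem u I.secondGreen_notMem_red, h2]
    -- Acceptance happens only after phase `L + i`, when `g₂` has been seen and must be beaten.
    have hle : (I.nth u).symm I.secondGreen ≤ k := by
      by_contra hlt
      have := I.monotone_phaseAt u L (not_le.mp hlt).le
      omega
    have := hk2 _ hle hpos
    rw [hval, hv2] at this
    exact this.le

/-- If each phase from `L` to `2 * L` has a red element better than the second-largest green
element, and the latter arrives earlier, then one of the rules that beat survivors wins. -/
theorem exists_wins_of_phase_lt (L : ℕ) (hn : n < 2 ^ L)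
    (hred : ∀ i : Fin L, ∃ e, ∃ he : e ∈ I.red,
      phase L (I.redTime ⟨e, he⟩) = L + i ∧ I.secondGreenValue < I.v e)
    (h2 : phase L (u I.secondGreen) < L) :
    ∃ i j : Fin L, Wins (fun k h => decision L (true, i, j) k (phasesAndRanks L k h)) I u := by
  have hval : ∀ e, I.valueAt u ((I.nth u).symm e) = I.v e := fun e => by simp [valueAt]
  have hph : ∀ e, I.phaseAt u L ((I.nth u).symm e) = phase L (I.arrival u e) := fun e => by
    simp [phaseAt]
  have hv2 : I.v I.secondGreen = I.secondGreenValue := by simp [secondGreen]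
  obtain ⟨i, hi, j, hj, ⟨k, hk, hz⟩, hgood⟩ := exists_beatsSurvivor (I.phaseAt u L) (I.valueAt u)
    hn (b := (I.nth u).symm I.secondGreen)
    (by rwa [hph, I.arrival_of_notMem u I.secondGreen_notMem_red]) (by
      intro q hq1 hq2
      obtain ⟨e, he, hpe, hve⟩ := hred ⟨q - L, by omega⟩
      refine ⟨(I.nth u).symm e, ?_, ?_⟩
      · rw [hph, arrival, dif_pos he, hpe]
        exact Nat.add_sub_cancel' hq1
      · rwa [hval, hval, hv2])
  refine ⟨⟨i, hi⟩, ⟨j, hj⟩, I.wins_of_forall_accepted u ⟨k, ?_⟩ fun k hk => ?_⟩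
  · exact (I.decision_true_iff u L ⟨i, hi⟩ ⟨j, hj⟩ k).mpr ⟨hk, hz⟩
  · obtain ⟨_, z, hz1, hz2, hz3⟩ := (I.decision_true_iff u L ⟨i, hi⟩ ⟨j, hj⟩ k).mp hk
    have := hgood k z hz1 hz2 hz3
    rwa [hval, hv2] at this

end Input

/-! ### Probability estimates -/

/-- If each point of `E` has a section of measure at least `a`, then the product measure of a set
is at least `a` times the measure of `E`. The set need not be measurable. -/
theorem mul_measure_le_prod {α β : Type*} [MeasurableSpace α] [MeasurableSpace β] (μ : Measure α)
    (ν : Measure β) [SFinite μ] [SFinite ν] (S : Set (α × β)) {E : Set β} (hE : MeasurableSet E)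
    (a : ENNReal) (h : ∀ y ∈ E, a ≤ μ {x | (x, y) ∈ S}) : a * ν E ≤ μ.prod ν S := by
  -- A measurable hull has the same product measure, which avoids proving that the winning event is
  -- measurable.
  rw [← measure_toMeasurable S, Measure.prod_apply_symm (measurableSet_toMeasurable _ _),
    ← setLIntegral_const]
  calc ∫⁻ _ in E, a ∂ν
      ≤ ∫⁻ y in E, μ ((fun x => (x, y)) ⁻¹' toMeasurable (μ.prod ν) S) ∂ν :=
        setLIntegral_mono' hE fun y hy =>
          (h y hy).trans (measure_mono fun x hx => subset_toMeasurable _ _ hx)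
    _ ≤ _ := setLIntegral_le_lintegral _ _

theorem le_volume_phase_preimage {L a b : ℕ} (hL : 0 < L) (hab : a ≤ b) (hb : b ≤ 3 * L) :
    ENNReal.ofReal ((b - a) / (3 * L)) ≤ volume (phase L ⁻¹' Set.Ico a b) := by
  have hL' : (0 : ℝ) < 3 * L := by positivity
  have hb' : (b : ℝ) ≤ 3 * L := by exact_mod_cast hb
  have hab' : (a : ℝ) ≤ b := by exact_mod_cast hab
  have hmem : ∀ c : ℕ, (c : ℝ) ≤ b → (c : ℝ) / (3 * L) ∈ Set.Icc (0 : ℝ) 1 := fun c hc =>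
    ⟨by positivity, (div_le_one hL').mpr (hc.trans hb')⟩
  have hvol := unitInterval.volume_Ico (x := ⟨_, hmem a hab'⟩) (y := ⟨_, hmem b le_rfl⟩)
  rw [sub_div, ← hvol]
  refine measure_mono fun t ht => ?_
  have h1 : (a : ℝ) / (3 * L) ≤ t := ht.1
  have h2 : (t : ℝ) < b / (3 * L) := ht.2
  rw [div_le_iff₀ hL'] at h1
  rw [lt_div_iff₀ hL'] at h2
  have h0 : 0 ≤ 3 * (L : ℝ) * t := mul_nonneg hL'.le t.2.1
  exact ⟨Nat.le_floor (by linarith), (Nat.floor_lt h0).mpr (by linarith)⟩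

theorem volume_eval_preimage {n : ℕ} (e : Fin n) {s : Set unitInterval} (hs : MeasurableSet s) :
    volume {u : Fin n → unitInterval | u e ∈ s} = volume s :=
  (measurePreserving_eval (fun _ : Fin n => (volume : Measure unitInterval)) e).measure_preimage hs.nullMeasurableSet

theorem volume_eval_inter_eval {n : ℕ} {e f : Fin n} (hef : e ≠ f) (s t : Set unitInterval) :
    volume {u : Fin n → unitInterval | u e ∈ s ∧ u f ∈ t} = volume s * volume t := by
  have hset : {u : Fin n → unitInterval | u e ∈ s ∧ u f ∈ t} =
      Set.pi Set.univ (fun x => if x = e then s else if x = f then t else Set.univ) := by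
    ext u
    simp only [Set.mem_ofPred_eq, Set.mem_pi, Set.mem_univ, true_implies]
    constructor
    · rintro ⟨h1, h2⟩ x
      split_ifs with hx hx'
      · exact hx ▸ h1
      · exact hx' ▸ h2
      · trivial
    · intro h
      have h1 := h e
      have h2 := h f
      rw [if_pos rfl] at h1
      rw [if_neg hef.symm, if_pos rfl] at h2
      exact ⟨h1, h2⟩
  rw [hset, volume_pi_pi, ← Finset.mul_prod_erase _ _ (Finset.mem_univ e),
    ← Finset.mul_prod_erase _ _ (Finset.mem_erase.mpr ⟨hef.symm, Finset.mem_univ f⟩), if_pos rfl,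
    if_neg hef.symm, if_pos rfl, Finset.prod_eq_one, mul_one]
  intro x hx
  simp only [Finset.mem_erase] at hx
  rw [if_neg hx.2.1, if_neg hx.1, measure_univ]

theorem ofReal_le_uniformOn_univ {α : Type*} [Fintype α] [MeasurableSpace α]
    [MeasurableSingletonClass α] {s : Set α} {t : Finset α} (h : (t : Set α) ⊆ s) :
    ENNReal.ofReal (t.card / Fintype.card α) ≤ ProbabilityTheory.uniformOn Set.univ s := by
  rcases isEmpty_or_nonempty α with hα | hα
  · simp
  rw [ProbabilityTheory.uniformOn_univ, ENNReal.ofReal_div_of_pos (by exact_mod_cast Fintype.card_pos),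
    ENNReal.ofReal_natCast, ENNReal.ofReal_natCast]
  refine ENNReal.div_le_div_right ?_ _
  rw [← Measure.count_apply_finset]
  exact measure_mono h

theorem numScales_pos (n : ℕ) : 0 < numScales n := Nat.succ_pos _

theorem card_seed (L : ℕ) : (Fintype.card (Seed L) : ℝ) = 2 * L ^ 2 := by
  simp only [Seed, Fintype.card_prod, Fintype.card_bool, Fintype.card_fin]
  push_cast
  ring

/-- The winning seeds `t` may vary with `u`; only their proportion among the `2L²` seeds matters. -/
theorem le_payoff_ordinalAlgorithm {n : ℕ} (I : Input n) {E : Set (Fin n → unitInterval)}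
    (hE : MeasurableSet E) {m : ℕ} {x : ℝ} (hx : ENNReal.ofReal x ≤ volume E)
    (h : ∀ u ∈ E, ∃ t : Finset (Seed (numScales n)), m ≤ t.card ∧
      ∀ ω ∈ t, Wins ((ordinalAlgorithm n).alg ω) I u) :
    m / (2 * (numScales n : ℝ) ^ 2) * x ≤ (ordinalAlgorithm n).payoff I := by
  let _ : MeasurableSpace (Seed (numScales n)) := ⊤
  have : MeasurableSingletonClass (Seed (numScales n)) := ⟨fun _ => trivial⟩
  have hprob : IsProbabilityMeasure (ProbabilityTheory.uniformOn
    (Set.univ : Set (Seed (numScales n)))) := (ordinalAlgorithm n).prob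
  change _ ≤ ((ProbabilityTheory.uniformOn (Set.univ : Set (Seed (numScales n)))).prod
    (volume : Measure (Fin n → unitInterval))).real
      {p | Wins ((ordinalAlgorithm n).alg p.1) I p.2}
  rw [Measure.real, ← ENNReal.ofReal_le_iff_le_toReal (measure_ne_top _ _),
    ENNReal.ofReal_mul (by positivity)]
  refine (mul_le_mul_right hx _).trans (mul_measure_le_prod _ _ _ hE _ fun u hu => ?_)
  obtain ⟨t, hmt, ht⟩ := h u hu
  refine le_trans (ENNReal.ofReal_le_ofReal ?_) (ofReal_le_uniformOn_univ (t := t) ht)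
  rw [card_seed]
  gcongr

theorem inv_le_payoff_ordinalAlgorithm {n : ℕ} (I : Input n) :
    1 / (18 * (numScales n : ℝ) ^ 2) ≤ (ordinalAlgorithm n).payoff I := by
  set L := numScales n with hLdef
  have hL : 0 < L := numScales_pos n
  have hL' : (0 : ℝ) < L := by exact_mod_cast hL
  have hmeas : ∀ s, MeasurableSet (phase L ⁻¹' s) := fun s =>
    measurable_phase L (MeasurableSet.of_discrete)
  by_cases hred : ∀ i : Fin L, ∃ e, ∃ he : e ∈ I.red,
      phase L (I.redTime ⟨e, he⟩) = L + i ∧ I.secondGreenValue < I.v e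
  · have hvol := le_volume_phase_preimage (L := L) (a := 0) (b := L) hL (by omega) (by omega)
    rw [← volume_eval_preimage I.secondGreen (hmeas _)] at hvol
    -- One winning seed and probability `1/3` give `1/(6L²)`.
    refine le_trans ?_ (le_payoff_ordinalAlgorithm I (m := 1)
      (measurable_pi_apply I.secondGreen (hmeas _)) hvol ?_)
    · rw [← hLdef]
      push_cast
      rw [sub_zero, div_mul_div_comm, div_le_div_iff₀ (by positivity) (by positivity)]
      nlinarith [pow_pos hL' 3]
    · intro u hu
      obtain ⟨i, j, hij⟩ := I.exists_wins_of_phase_lt u L (Nat.lt_pow_succ_log_self one_lt_two n)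
        hred hu.2
      exact ⟨{(true, i, j)}, by simp, fun ω hω => by rw [Finset.mem_singleton.mp hω]; exact hij⟩
  · push Not at hred
    obtain ⟨i, hi⟩ := hred
    have hi2 := i.2
    have hvol2 := le_volume_phase_preimage (L := L) (a := L + i) (b := L + i + 1) hL (by omega)
      (by omega)
    have hvol1 := le_volume_phase_preimage (L := L) (a := 2 * L) (b := 3 * L) hL (by omega) le_rfl
    have hvol := mul_le_mul' hvol2 hvol1
    rw [← volume_eval_inter_eval I.topGreen_ne_secondGreen.symm,
      ← ENNReal.ofReal_mul (by push_cast; ring_nf; positivity)] at hvol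
    have heval : ∀ (e : Fin n) (s : Set ℕ),
        MeasurableSet {u : Fin n → unitInterval | u e ∈ phase L ⁻¹' s} :=
      fun e s => measurable_pi_apply e (hmeas s)
    -- All `L` values of `j` win: `L/(2L²) · 1/(3L) · 1/3 = 1/(18L²)`.
    refine le_trans ?_ (le_payoff_ordinalAlgorithm I (m := L)
      ((heval I.secondGreen (Set.Ico (L + i) (L + i + 1))).inter
        (heval I.topGreen (Set.Ico (2 * L) (3 * L)))) hvol ?_)
    · rw [← hLdef]
      push_cast
      apply le_of_eq
      field_simp
      ring
    · intro u hu
      refine ⟨Finset.univ.map ⟨fun j : Fin L => (false, i, j), fun a b h => by simpa using h⟩,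
        by simp, fun ω hω => ?_⟩
      obtain ⟨j, _, rfl⟩ := Finset.mem_map.mp hω
      have h2 := hu.1
      have h1 := hu.2
      simp only [Set.mem_preimage, Set.mem_Ico, Set.mem_ofPred_eq] at h1 h2
      exact I.wins_of_phase_eq u L i j hi (by omega) (by omega)

theorem numScales_le_mul_log {n : ℕ} (hn : 2 ≤ n) : (numScales n : ℝ) ≤ 4 * Real.log n := by
  have hlog2 : (1 / 2 : ℝ) < Real.log 2 := by linarith [Real.log_two_gt_d9]
  have h1 : (Nat.log 2 n : ℝ) * Real.log 2 ≤ Real.log n := by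
    rw [← Real.log_pow]
    refine Real.log_le_log (by positivity) ?_
    exact_mod_cast Nat.pow_log_le_self 2 (by omega)
  have h2 : Real.log 2 ≤ Real.log n := Real.log_le_log two_pos (by exact_mod_cast hn)
  have h3 : (0 : ℝ) ≤ Nat.log 2 n := Nat.cast_nonneg _
  unfold numScales
  push_cast
  nlinarith

end ByzantineSecretary

theorem theorem4 :
    ∃ c : ℝ, 0 < c ∧
      ∃ A : (n : ℕ) → ByzantineSecretary.RandAlgorithm n,
        ∀ n : ℕ, 2 ≤ n → ∀ I : ByzantineSecretary.Input n,
          c / (Real.log n) ^ 2 ≤ (A n).payoff I := by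
  -- `288 = 18 · 4²`, with the `4` from `numScales_le_mul_log`.
  refine ⟨1 / 288, by norm_num, ByzantineSecretary.ordinalAlgorithm, fun n hn I => ?_⟩
  refine le_trans ?_ (ByzantineSecretary.inv_le_payoff_ordinalAlgorithm I)
  have hlog : 0 < Real.log n := Real.log_pos (by exact_mod_cast (show 1 < n by omega))
  have hpos : (0 : ℝ) < ByzantineSecretary.numScales n := by
    exact_mod_cast ByzantineSecretary.numScales_pos n
  rw [div_div]
  refine one_div_le_one_div_of_le (by positivity) ?_
  have := pow_le_pow_left₀ hpos.le (ByzantineSecretary.numScales_le_mul_log hn) 2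
  nlinarith
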